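/- Let $X_c=\{x_0,\dots,x_{m_c}\}$ and $X_d=\{\tilde x_0,\dots,\tilde x_{m_d}\}$ be alphabets and let $c\in\mathbb R^{m_d}\langle\langle X_c\rangle\rangle$, $d\in\mathbb R^{m_c}\langle\langle X_d\rangle\rangle$ be arbitrary noncommutative formal power series (maps from words to $\mathbb R^{m_d}$, resp. $\mathbb R^{m_c}$). Notation. Let $\mathbin{\sqcup\!\sqcup}$ be the shuffle product. For $a\in\mathbb R^{\ell}\langle\langle \{z_0,\dots,z_n\}\rangle\rangle$ and $b\in\mathbb R^{n}\langle\langle X\rangle\rangle$, $X=\{x_0,\dots,x_m\}$, the composition product is $a\circ b=\sum_\eta (a,\eta)\,\psi_b(\eta)(1)$, where $\psi_b(z_{i_1}\cdots z_{i_k})=\psi_b(z_{i_1})\cdots\psi_b(z_{i_k})$ and $\psi_b(z_i)(e)=x_0(b_i \mathbin{\sqcup\!\sqcup} e)$ with $b_0:=1$. For $a\in\mathbb R^{\ell}\langle\langle X\rangle\rangle$ and $b\in\mathbb R^m\langle\langle X\rangle\rangle$ the modified composition product is $a\,\tilde\circ\, b=\sum_\eta (a,\eta)\,\phi_b(\eta)(1)$,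 where $\phi_b$ is extended to words in the same way from $\phi_b(x_i)(e)=x_ie+x_0(b_i \mathbin{\sqcup\!\sqcup} e)$ with $b_0:=0$. With $\delta$ the (fictitious) generating series of the identity operator, let $a\circ(\delta+b)$ denote the composition product formed with $\psi_{\delta+b}(x_0)(e)=x_0e$ and $\psi_{\delta+b}(x_i)(e)=x_ie+x_0(b_i \mathbin{\sqcup\!\sqcup} e)$ for $i\ge 1$, and on the set of formal sums $\delta+b$, $b\in\mathbb R^m\langle\langle X\rangle\rangle$, put $(\delta+a)\circ(\delta+b)=\delta+b+a\,\tilde\circ\,b$. For a series $a$ over $\{x_0,\dots,x_m\}$ and a tuple $u=(u_1,\dots,u_m)$ of formal power series in $t$, let $F_a[u]=\sum_\eta (a,\eta)E_\eta[u]$ be the (formal) Fliess operator, where $E_\emptyset[u]=1$, $E_{x_i\eta}[u](t)=\int_0^t u_i(\tau)E_\eta[u](\tau)\,d\tau$ and $u_0:=1$. Theorem. (i) The formal sums $\delta+b$, $b\in\mathbb R^{m_c}\langle\langle X_c\rangle\rangle$, form a group under $\circ$ with unit $\delta$ (the output feedback group). Write $(\delta+b)^{-1}=\delta+b^{-1}$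 for its inverse. (ii) There is exactly one series $c@d\in\mathbb R^{m_d}\langle\langle X_c\rangle\rangle$, the feedback product, that generates the feedback connection of $F_c$ and $F_d$: for every input $u$, the equations $v=u+F_d[y]$, $y=F_c[v]$ hold for exactly one output $y$, namely $y=F_{c@d}[u]$. It is also the unique solution $e$ of $e=c\,\tilde\circ\,(d\circ e)$. (iii) $$c@d \;=\; c\,\tilde\circ\,(-d\circ c)^{-1} \;=\; c\circ(\delta-d\circ c)^{-1}.$$ -/

import Mathlib

noncomputable section

namespace FliessSeries

/-- Words over the alphabet `X = {x₀, x₁, …, x_m}`; the letter `x_i` is `i : Fin (m + 1)`. -/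
abbrev Word (m : ℕ) : Type := List (Fin (m + 1))

/-- Scalar formal power series `ℝ⟨⟨X⟩⟩`. -/
abbrev ScalarSeries (m : ℕ) : Type := Word m → ℝ

/-- Formal power series `ℝ^ℓ⟨⟨X⟩⟩`, i.e. maps `X* → ℝ^ℓ`. -/
abbrev Series (m ℓ : ℕ) : Type := Word m → Fin ℓ → ℝ

/-- The `i`-th component series of `c`. -/
def component {m ℓ : ℕ} (c : Series m ℓ) (i : Fin ℓ) : ScalarSeries m := fun η => c η i

/-- The series `1 = 1 ∅`. -/
def unit (m : ℕ) : ScalarSeries m := fun η => if η = [] then 1 else 0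

/-- The catenation `x_i e` of a letter and a series. -/
def letterMul {m : ℕ} (i : Fin (m + 1)) (e : ScalarSeries m) : ScalarSeries m
  | [] => 0
  | j :: η => if j = i then e η else 0

/-- The shuffle product of two words, as the list (with multiplicities) of the words in it. -/
def shuffleWords {m : ℕ} : Word m → Word m → List (Word m)
  | [], ξ => [ξ]
  | i :: η, [] => [i :: η]
  | i :: η, j :: ξ =>
      (shuffleWords η (j :: ξ)).map (fun ζ => i :: ζ) ++
        (shuffleWords (i :: η) ξ).map (fun ζ => j :: ζ)
termination_by η ξ => η.length + ξ.length

/-- The shuffle product of series, the bilinear extension of the shuffle product of words.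
For every word `ζ` only the finitely many pairs with `|η| + |ξ| = |ζ|` contribute. -/
def shuffle {m : ℕ} (c d : ScalarSeries m) : ScalarSeries m := fun ζ =>
  ∑ᶠ p : Word m × Word m, c p.1 * d p.2 * ((shuffleWords p.1 p.2).count ζ : ℝ)

/-- The multiplicative extension to words of a family of maps indexed by the letters of an
alphabet with `n + 1` letters: `x_{i₁} ⋯ x_{i_k} ↦ φ(x_{i₁}) ∘ ⋯ ∘ φ(x_{i_k})`. -/
def extendToWords {m n : ℕ} (φ : Fin (n + 1) → ScalarSeries m → ScalarSeries m) :
    Word n → ScalarSeries m → ScalarSeries m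
  | [], e => e
  | i :: η, e => φ i (extendToWords φ η e)

/-- `∑_η (c, η) φ(η)(1)`. In every use below `φ(x_i)` raises the order of a series by at least one,
so that for every word `ξ` only the finitely many `η` with `|η| ≤ |ξ|` contribute. -/
def substitute {m n ℓ : ℕ} (φ : Fin (n + 1) → ScalarSeries m → ScalarSeries m)
    (c : Series n ℓ) : Series m ℓ := fun ξ k =>
  ∑ᶠ η : Word n, c η k * extendToWords φ η (unit m) ξ

/-- `ψ_d(x_i)(e) = x₀ (d_i ⧢ e)` with `d₀ = 1`. -/
def psi {m n : ℕ} (d : Series m n) (i : Fin (n + 1)) (e : ScalarSeries m) : ScalarSeries m :=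
  letterMul 0 (shuffle (Fin.cases (unit m) (component d) i) e)

/-- The composition product `c ∘ d`, where `c` is a series over an alphabet with `n + 1` letters
and `d` is an `ℝⁿ`-valued series over a possibly different alphabet. -/
def comp {m n ℓ : ℕ} (c : Series n ℓ) (d : Series m n) : Series m ℓ := substitute (psi d) c

/-- `φ_d(x_i)(e) = x_i e + x₀ (d_i ⧢ e)` with `d₀ = 0`. -/
def phi {m : ℕ} (d : Series m m) (i : Fin (m + 1)) (e : ScalarSeries m) : ScalarSeries m :=
  letterMul i e + letterMul 0 (shuffle (Fin.cases 0 (component d) i) e)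

/-- The modified composition product of `c` and `d`. -/
def modComp {m ℓ : ℕ} (c : Series m ℓ) (d : Series m m) : Series m ℓ := substitute (phi d) c

/-- The formal sums `δ + c` with `c ∈ ℝ^m⟨⟨X⟩⟩`, where `δ` is the fictitious generating series of
the identity operator. The element `⟨c⟩` is `δ + c`. -/
@[ext]
structure DeltaSeries (m : ℕ) : Type where
  series : Series m m

/-- The unit of the output feedback group is `δ`. -/
instance (m : ℕ) : One (DeltaSeries m) := ⟨⟨0⟩⟩

/-- The product of the output feedback group:
`(δ + c) ∘ (δ + d) = δ + d + (modified composition of c and d)`. -/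
instance (m : ℕ) : Mul (DeltaSeries m) := ⟨fun a b => ⟨b.series + modComp a.series b.series⟩⟩

/-- The inverse in the output feedback group: the two-sided inverse with respect to the product
above. (That this structure is a group is asserted together with the main result.) -/
instance (m : ℕ) : Inv (DeltaSeries m) :=
  ⟨fun a => Classical.epsilon fun b => a * b = 1 ∧ b * a = 1⟩

/-- The series `c⁻¹` defined by `(δ + c)⁻¹ = δ + c⁻¹`. -/
def groupInv {m : ℕ} (c : Series m m) : Series m m := ((⟨c⟩ : DeltaSeries m)⁻¹).series

/-- `ψ_{δ+w}(x_i)(e) = x₀ ((δ_i + w_i) ⧢ e)`, where `x₀ (δ_i ⧢ e) = x_i e` because `δ_i` generates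
the `i`-th input; for `i = 0` the series in the bracket is `1`. -/
def psiDelta {m : ℕ} (a : DeltaSeries m) (i : Fin (m + 1)) (e : ScalarSeries m) :
    ScalarSeries m :=
  Fin.cases (letterMul 0 e)
    (fun j => letterMul j.succ e + letterMul 0 (shuffle (component a.series j) e)) i

/-- The composition product `c ∘ (δ + w)`. -/
def compDelta {m ℓ : ℕ} (c : Series m ℓ) (a : DeltaSeries m) : Series m ℓ :=
  substitute (psiDelta a) c

/-- Formal signals: `n`-tuples of formal power series in time. -/
abbrev Signal (n : ℕ) : Type := Fin n → PowerSeries ℝ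

/-- The formal integral from `0` to `t`. -/
def integral (f : PowerSeries ℝ) : PowerSeries ℝ :=
  PowerSeries.mk fun n => if n = 0 then 0 else PowerSeries.coeff (n - 1) f / (n : ℝ)

/-- The iterated integrals `E_∅[u] = 1`, `E_{x_i η}[u](t) = ∫₀ᵗ u_i E_η[u]`, with `u₀ = 1`. -/
def iteratedIntegral {m : ℕ} (u : Signal m) : Word m → PowerSeries ℝ
  | [] => 1
  | i :: η => integral (Fin.cases (1 : PowerSeries ℝ) u i * iteratedIntegral u η)

/-- The Fliess operator `F_c[u] = ∑_η (c, η) E_η[u]` on formal signals. It is defined for every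
series `c`: since `E_η[u]` has order at least `|η|`, only finitely many words contribute to each
coefficient. -/
def fliess {m ℓ : ℕ} (c : Series m ℓ) (u : Signal m) : Signal ℓ := fun k =>
  PowerSeries.mk fun n => ∑ᶠ η : Word m, c η k * PowerSeries.coeff n (iteratedIntegral u η)

/-- `e` is a generating series of the feedback connection of `F_c` (forward path) and `F_d`
(feedback path): for every input `u` the loop equations `v = u + F_d[y]`, `y = F_c[v]` hold for
exactly one output `y`, namely `y = F_e[u]`. -/
def IsFeedbackSeries {mc md : ℕ} (c : Series mc md) (d : Series md mc) (e : Series mc md) : Prop :=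
  ∀ (u : Signal mc) (y : Signal md),
    (∃ v : Signal mc, v = u + fliess d y ∧ y = fliess c v) ↔ y = fliess e u

/-- The feedback product `c @ d`: the generating series of the feedback connection. (Its existence
and uniqueness are asserted together with the main result.) -/
def feedback {mc md : ℕ} (c : Series mc md) (d : Series md mc) : Series mc md :=
  Classical.epsilon (IsFeedbackSeries c d)

end FliessSeries

end

open FliessSeries

noncomputable section

namespace FliessSeries

open PowerSeries

/-! ### Finite sums over words -/

/-! All identities are transported from series to operators on formal signals. The map `c ↦ F_c` is
injective (`fliess_injective`), it turns `d ∘ c` into composition (`fliess_comp`), and it turns the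
modified composition into `u ↦ F_c[u + F_d[u]]` (`fliess_modComp`). Hence `δ + b` acts faithfully as
`u ↦ u + F_b[u]`, with product equal to composition of maps, and associativity and the unit laws are
inherited.

Inverses come from the fixed point of `b ↦ -(a õ b)`: a coefficient of `a õ b` at a word depends on
`b` only at shorter words (`modComp_congr`), so the iteration stabilises. Eliminating `y` from the
loop gives `v - F_{d∘c}[v] = u`, so `v` is the image of `u` under `(δ - d∘c)⁻¹` and `y = F_c[v]`.

The operator identities follow from `F_c[u]' = ∑ u_i F_{x_i⁻¹c}[u]` by induction on the order of
agreement in `t`. Injectivity is the analytic point: perturbing `u_i` by `X ^ p` and letting `p → ∞`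
recovers `F_{x_i⁻¹c}[u]` from `F_c`, so letters can be stripped one at a time. -/

theorem finsum_comp_of_support_subset_range {α β : Type*} {f : α → ℝ} {g : β → α}
    (hg : Function.Injective g) (hf : ∀ x, x ∉ Set.range g → f x = 0) :
    ∑ᶠ x, f x = ∑ᶠ y, f (g y) := by
  rw [← finsum_mem_range hg, ← finsum_mem_univ]
  refine finsum_mem_inter_support_eq' f _ _ fun x hx => ?_
  simp only [Set.mem_univ, true_iff]
  by_contra h
  exact hx (hf x h)

/-- The words of length at most `n`. -/
def wordsUpTo (m n : ℕ) : Finset (Word m) := (List.finite_length_le (Fin (m + 1)) n).toFinset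

theorem mem_wordsUpTo {m n : ℕ} {η : Word m} : η ∈ wordsUpTo m n ↔ η.length ≤ n := by
  simp [wordsUpTo]

theorem finsum_eq_sum_wordsUpTo {m n : ℕ} {f : Word m → ℝ}
    (hf : ∀ η, n < η.length → f η = 0) : ∑ᶠ η, f η = ∑ η ∈ wordsUpTo m n, f η := by
  refine finsum_eq_sum_of_support_subset f fun η hη => ?_
  rw [Finset.mem_coe, mem_wordsUpTo]
  by_contra h
  exact hη (hf η (not_le.mp h))

/-- The length bound makes the supports finite; `∑ᶠ` over an infinite support would default to `0`
and break the splitting. -/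
theorem finsum_word_cons {m n : ℕ} {f : Word m → ℝ} (hf : ∀ η, n < η.length → f η = 0) :
    ∑ᶠ η, f η = f [] + ∑ i, ∑ᶠ η, f (i :: η) := by
  classical
  have hinj : Function.Injective (fun p : Fin (m + 1) × Word m => p.1 :: p.2) := by
    rintro ⟨i, η⟩ ⟨j, ξ⟩ h
    simpa using h
  have h1 : ∑ᶠ η, f η = ∑ η ∈ insert []
      ((Finset.univ ×ˢ wordsUpTo m n).map ⟨fun p : Fin (m + 1) × Word m => p.1 :: p.2, hinj⟩),
      f η := by
    refine finsum_eq_sum_of_support_subset f fun η hη => ?_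
    have hle : η.length ≤ n := by
      by_contra h
      exact hη (hf η (not_le.mp h))
    cases η with
    | nil => simp
    | cons i η =>
      simp only [List.length_cons] at hle
      simp [mem_wordsUpTo]
      omega
  rw [h1, Finset.sum_insert (by simp), Finset.sum_map, Finset.sum_product]
  congr 1
  refine Finset.sum_congr rfl fun i _ => ?_
  rw [finsum_eq_sum_wordsUpTo (n := n)]
  · rfl
  · intro η h
    exact hf _ (by simp; omega)

/-! ### The shuffle product -/

/-- The left shift `x_i⁻¹ c`. -/
def shift {m : ℕ} (i : Fin (m + 1)) (c : ScalarSeries m) : ScalarSeries m := fun η => c (i :: η)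

theorem length_of_mem_shuffleWords {m : ℕ} : ∀ {η ξ ζ : Word m}, ζ ∈ shuffleWords η ξ →
    ζ.length = η.length + ξ.length
  | [], ξ, ζ, h => by simp [shuffleWords] at h; simp [h]
  | i :: η, [], ζ, h => by simp [shuffleWords] at h; simp [h]
  | i :: η, j :: ξ, ζ, h => by
    simp only [shuffleWords, List.mem_append, List.mem_map] at h
    rcases h with ⟨ζ', h, rfl⟩ | ⟨ζ', h, rfl⟩
    · have := length_of_mem_shuffleWords h
      simp only [List.length_cons] at *
      omega
    · have := length_of_mem_shuffleWords h
      simp only [List.length_cons] at *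
      omega
termination_by η ξ => η.length + ξ.length

theorem count_shuffleWords_of_length_ne {m : ℕ} {η ξ ζ : Word m}
    (h : ζ.length ≠ η.length + ξ.length) : (shuffleWords η ξ).count ζ = 0 :=
  List.count_eq_zero.mpr fun h' => h (length_of_mem_shuffleWords h')

/-- The number of occurrences of `ζ` in the shuffle of `x_j⁻¹ η` and `ξ`. -/
def countShiftLeft {m : ℕ} (j : Fin (m + 1)) (ζ : Word m) : Word m → Word m → ℕ
  | [], _ => 0
  | i :: η, ξ => if i = j then (shuffleWords η ξ).count ζ else 0

/-- The number of occurrences of `ζ` in the shuffle of `η` and `x_j⁻¹ ξ`. -/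
def countShiftRight {m : ℕ} (j : Fin (m + 1)) (ζ : Word m) : Word m → Word m → ℕ
  | _, [] => 0
  | η, i :: ξ => if i = j then (shuffleWords η ξ).count ζ else 0

theorem count_map_cons {m : ℕ} (i j : Fin (m + 1)) (ζ : Word m) (l : List (Word m)) :
    (l.map (fun ζ => i :: ζ)).count (j :: ζ) = if i = j then l.count ζ else 0 := by
  split_ifs with h
  · subst h
    exact List.count_map_of_injective l _ (List.cons_injective) ζ
  · rw [List.count_eq_zero]
    simp [h]

theorem shuffleWords_nil_right {m : ℕ} (η : Word m) : shuffleWords η [] = [η] := by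
  cases η <;> simp [shuffleWords]

theorem count_cons_shuffleWords {m : ℕ} (j : Fin (m + 1)) (ζ η ξ : Word m) :
    (shuffleWords η ξ).count (j :: ζ) =
      countShiftLeft j ζ η ξ + countShiftRight j ζ η ξ := by
  rcases η with - | ⟨i, η⟩ <;> rcases ξ with - | ⟨k, ξ⟩
  · simp [shuffleWords, countShiftLeft, countShiftRight]
  · simp [shuffleWords, countShiftLeft, countShiftRight, List.count_singleton]
    grind
  · simp [countShiftLeft, countShiftRight, List.count_singleton, shuffleWords_nil_right]
    grind
  · rw [shuffleWords, List.count_append, count_map_cons, count_map_cons]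
    rfl

theorem shuffle_support_finite {m : ℕ} (c d : ScalarSeries m) (ζ : Word m) :
    (Function.support fun p : Word m × Word m =>
      c p.1 * d p.2 * ((shuffleWords p.1 p.2).count ζ : ℝ)) ⊆
      ((wordsUpTo m ζ.length ×ˢ wordsUpTo m ζ.length : Finset (Word m × Word m)) :
        Set (Word m × Word m)) := by
  intro p hp
  have : ζ.length = p.1.length + p.2.length := by
    by_contra h
    exact hp (by simp [count_shuffleWords_of_length_ne h])
  simp only [Finset.coe_product, Set.mem_prod, Finset.mem_coe, mem_wordsUpTo]
  omega

theorem shuffle_eq_sum {m : ℕ} (c d : ScalarSeries m) (ζ : Word m) :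
    shuffle c d ζ = ∑ p ∈ wordsUpTo m ζ.length ×ˢ wordsUpTo m ζ.length,
      c p.1 * d p.2 * ((shuffleWords p.1 p.2).count ζ : ℝ) :=
  finsum_eq_sum_of_support_subset _ (shuffle_support_finite c d ζ)

theorem shuffle_nil {m : ℕ} (c d : ScalarSeries m) : shuffle c d [] = c [] * d [] := by
  rw [shuffle_eq_sum]
  have : wordsUpTo m 0 = {[]} := by
    ext η
    simp [mem_wordsUpTo]
  simp [this, shuffleWords]

/-- The first letter of a shuffled word comes from one factor or the other, so left shifts are
derivations. Together with `shuffle_nil` this recursion replaces counting in most later arguments.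
-/
theorem shuffle_cons {m : ℕ} (c d : ScalarSeries m) (j : Fin (m + 1)) (ζ : Word m) :
    shuffle c d (j :: ζ) = shuffle (shift j c) d ζ + shuffle c (shift j d) ζ := by
  have e1 : shuffle (shift j c) d ζ =
      ∑ᶠ p : Word m × Word m, c p.1 * d p.2 * (countShiftLeft j ζ p.1 p.2 : ℝ) := by
    have hinj : Function.Injective (fun p : Word m × Word m => (j :: p.1, p.2)) := by
      rintro ⟨_, _⟩ ⟨_, _⟩ h
      simpa using h
    rw [finsum_comp_of_support_subset_range hinj]
    · simp [shuffle, shift, countShiftLeft]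
    · rintro ⟨η, ξ⟩ h
      rcases η with - | ⟨i, η⟩
      · simp [countShiftLeft]
      · have : i ≠ j := by
          rintro rfl
          exact h ⟨(η, ξ), rfl⟩
        simp [countShiftLeft, this]
  have e2 : shuffle c (shift j d) ζ =
      ∑ᶠ p : Word m × Word m, c p.1 * d p.2 * (countShiftRight j ζ p.1 p.2 : ℝ) := by
    have hinj : Function.Injective (fun p : Word m × Word m => (p.1, j :: p.2)) := by
      rintro ⟨_, _⟩ ⟨_, _⟩ h
      simpa using h
    rw [finsum_comp_of_support_subset_range hinj]
    · simp [shuffle, shift, countShiftRight]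
    · rintro ⟨η, ξ⟩ h
      rcases ξ with - | ⟨i, ξ⟩
      · simp [countShiftRight]
      · have : i ≠ j := by
          rintro rfl
          exact h ⟨(η, ξ), rfl⟩
        simp [countShiftRight, this]
  have hfin := (Finset.finite_toSet _).subset (shuffle_support_finite c d (j :: ζ))
  rw [e1, e2, ← finsum_add_distrib]
  · refine finsum_congr fun p => ?_
    rw [count_cons_shuffleWords]
    push_cast
    ring
  -- The two counts are natural numbers, so a vanishing sum forces each to vanish; finiteness of the
  -- total support then passes to each part.
  · refine hfin.subset fun p hp h => hp ?_
    beta_reduce at h ⊢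
    rw [count_cons_shuffleWords, mul_eq_zero] at h
    rcases h with h | h
    · simp [h]
    · rw [Nat.cast_eq_zero, Nat.add_eq_zero_iff] at h
      simp [h.1]
  · refine hfin.subset fun p hp h => hp ?_
    beta_reduce at h ⊢
    rw [count_cons_shuffleWords, mul_eq_zero] at h
    rcases h with h | h
    · simp [h]
    · rw [Nat.cast_eq_zero, Nat.add_eq_zero_iff] at h
      simp [h.2]

theorem shift_shuffle {m : ℕ} (c d : ScalarSeries m) (j : Fin (m + 1)) :
    shift j (shuffle c d) = shuffle (shift j c) d + shuffle c (shift j d) :=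
  funext fun ζ => shuffle_cons c d j ζ

theorem shuffle_congr {m : ℕ} {c c' d d' : ScalarSeries m} {ζ : Word m}
    (hc : ∀ η : Word m, η.length ≤ ζ.length → c η = c' η)
    (hd : ∀ η : Word m, η.length ≤ ζ.length → d η = d' η) :
    shuffle c d ζ = shuffle c' d' ζ := by
  rw [shuffle_eq_sum, shuffle_eq_sum]
  refine Finset.sum_congr rfl fun p hp => ?_
  rw [Finset.mem_product, mem_wordsUpTo, mem_wordsUpTo] at hp
  rw [hc _ hp.1, hd _ hp.2]

theorem shuffle_zero_left {m : ℕ} (d : ScalarSeries m) : shuffle 0 d = 0 :=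
  funext fun ζ => by simp [shuffle]

theorem shuffle_zero_right {m : ℕ} (d : ScalarSeries m) : shuffle d 0 = 0 :=
  funext fun ζ => by simp [shuffle]

theorem shuffle_add_left {m : ℕ} (a b d : ScalarSeries m) :
    shuffle (a + b) d = shuffle a d + shuffle b d :=
  funext fun ζ => by
    simp only [Pi.add_apply, shuffle_eq_sum, ← Finset.sum_add_distrib]
    exact Finset.sum_congr rfl fun p _ => by ring

theorem shift_unit {m : ℕ} (i : Fin (m + 1)) : shift i (unit m) = 0 :=
  funext fun ζ => by simp [shift, unit]

theorem unit_shuffle {m : ℕ} (d : ScalarSeries m) : shuffle (unit m) d = d := by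
  funext ζ
  induction ζ generalizing d with
  | nil => simp [shuffle_nil, unit]
  | cons j ζ ih => rw [shuffle_cons, ih, shift_unit, shuffle_zero_left]; simp [shift]

/-! ### Scalar Fliess operators -/

/-- The input `u` together with `u₀ = 1`. -/
def extendedInput {m : ℕ} (u : Signal m) (i : Fin (m + 1)) : PowerSeries ℝ :=
  Fin.cases (1 : PowerSeries ℝ) u i

/-- The Fliess operator of a scalar series. -/
def scalarFliess {m : ℕ} (c : ScalarSeries m) (u : Signal m) : PowerSeries ℝ :=
  PowerSeries.mk fun n => ∑ᶠ η : Word m, c η * coeff n (iteratedIntegral u η)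

theorem fliess_apply {m ℓ : ℕ} (c : Series m ℓ) (u : Signal m) (k : Fin ℓ) :
    fliess c u k = scalarFliess (component c k) u := rfl

theorem derivative_integral (f : PowerSeries ℝ) : d⁄dX ℝ (integral f) = f := by
  ext n
  rw [coeff_derivative, integral, coeff_mk]
  have : (n : ℝ) + 1 ≠ 0 := by positivity
  simp
  field_simp

theorem coeff_iteratedIntegral_eq_zero {m : ℕ} (u : Signal m) (η : Word m) :
    ∀ n, n < η.length → coeff n (iteratedIntegral u η) = 0 := by
  induction η with
  | nil => simp
  | cons i η ih =>
    intro n hn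
    rw [iteratedIntegral, integral, coeff_mk]
    split_ifs with h
    · rfl
    · rw [coeff_mul, Finset.sum_eq_zero, zero_div]
      intro p hp
      rw [Finset.HasAntidiagonal.mem_antidiagonal] at hp
      rw [ih p.2 (by simp at hn; omega), mul_zero]

/-- The slack `n ≤ N` lets a single index set serve all the coefficients in a Cauchy product. -/
theorem coeff_scalarFliess {m : ℕ} (c : ScalarSeries m) (u : Signal m) {n N : ℕ} (h : n ≤ N) :
    coeff n (scalarFliess c u) =
      ∑ η ∈ wordsUpTo m N, c η * coeff n (iteratedIntegral u η) := by
  rw [scalarFliess, coeff_mk]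
  refine finsum_eq_sum_wordsUpTo fun η hη => ?_
  rw [coeff_iteratedIntegral_eq_zero u η n (by omega), mul_zero]

theorem constantCoeff_scalarFliess {m : ℕ} (c : ScalarSeries m) (u : Signal m) :
    constantCoeff (scalarFliess c u) = c [] := by
  rw [← coeff_zero_eq_constantCoeff_apply, coeff_scalarFliess c u le_rfl]
  have : wordsUpTo m 0 = {[]} := by
    ext η
    simp [mem_wordsUpTo]
  simp [this, iteratedIntegral]

/-- Differentiating an iterated integral removes the outermost integration, which strips the first
letter of the word. -/
theorem derivative_scalarFliess {m : ℕ} (c : ScalarSeries m) (u : Signal m) :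
    d⁄dX ℝ (scalarFliess c u) = ∑ i, extendedInput u i * scalarFliess (shift i c) u := by
  ext n
  rw [coeff_derivative, scalarFliess, coeff_mk, finsum_word_cons (n := n + 1)]
  · rw [iteratedIntegral, coeff_one, if_neg n.succ_ne_zero, mul_zero, zero_add, map_sum,
      Finset.sum_mul]
    refine Finset.sum_congr rfl fun i _ => ?_
    rw [finsum_eq_sum_wordsUpTo (n := n)]
    · rw [Finset.sum_mul, coeff_mul]
      have : ∀ p ∈ Finset.HasAntidiagonal.antidiagonal n,
          coeff p.1 (extendedInput u i) * coeff p.2 (scalarFliess (shift i c) u) =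
          ∑ η ∈ wordsUpTo m n, c (i :: η) *
            (coeff p.1 (extendedInput u i) * coeff p.2 (iteratedIntegral u η)) := by
        intro p hp
        rw [Finset.HasAntidiagonal.mem_antidiagonal] at hp
        rw [coeff_scalarFliess _ u (show p.2 ≤ n by omega), Finset.mul_sum]
        exact Finset.sum_congr rfl fun η _ => by rw [shift]; ring
      rw [Finset.sum_congr rfl this, Finset.sum_comm]
      refine Finset.sum_congr rfl fun η _ => ?_
      rw [← Finset.mul_sum, ← coeff_mul, mul_assoc, ← coeff_derivative, iteratedIntegral,
        derivative_integral]
      rfl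
    · intro η hη
      rw [coeff_iteratedIntegral_eq_zero _ _ _ (by simpa using hη), mul_zero]
  · intro η hη
    rw [coeff_iteratedIntegral_eq_zero _ _ _ hη, mul_zero]

/-! ### Agreement of power series to a given order -/

/-- `f` and `g` agree modulo `X ^ n`. -/
def EqUpTo (n : ℕ) (f g : PowerSeries ℝ) : Prop := ∀ k < n, coeff k f = coeff k g

theorem EqUpTo.refl (n : ℕ) (f : PowerSeries ℝ) : EqUpTo n f f := fun _ _ => rfl

theorem eq_of_forall_eqUpTo {f g : PowerSeries ℝ} (h : ∀ n, EqUpTo n f g) : f = g :=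
  PowerSeries.ext fun n => h (n + 1) n n.lt_succ_self

theorem EqUpTo.mono {n k : ℕ} {f g : PowerSeries ℝ} (h : EqUpTo n f g) (hk : k ≤ n) :
    EqUpTo k f g := fun l hl => h l (by omega)

theorem EqUpTo.add {n : ℕ} {f g f' g' : PowerSeries ℝ} (h : EqUpTo n f g) (h' : EqUpTo n f' g') :
    EqUpTo n (f + f') (g + g') := fun k hk => by rw [map_add, map_add, h k hk, h' k hk]

theorem EqUpTo.mul {n : ℕ} {f g f' g' : PowerSeries ℝ} (h : EqUpTo n f g) (h' : EqUpTo n f' g') :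
    EqUpTo n (f * f') (g * g') := fun k hk => by
  rw [coeff_mul, coeff_mul]
  refine Finset.sum_congr rfl fun p hp => ?_
  rw [Finset.HasAntidiagonal.mem_antidiagonal] at hp
  rw [h _ (by omega), h' _ (by omega)]

theorem EqUpTo.sum {ι : Type*} {s : Finset ι} {n : ℕ} {f g : ι → PowerSeries ℝ}
    (h : ∀ i ∈ s, EqUpTo n (f i) (g i)) : EqUpTo n (∑ i ∈ s, f i) (∑ i ∈ s, g i) :=
  fun k hk => by
    rw [map_sum, map_sum]
    exact Finset.sum_congr rfl fun i hi => h i hi k hk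

theorem EqUpTo.of_derivative {n : ℕ} {f g : PowerSeries ℝ}
    (h0 : constantCoeff f = constantCoeff g) (h : EqUpTo n (d⁄dX ℝ f) (d⁄dX ℝ g)) :
    EqUpTo (n + 1) f g := fun k hk => by
  cases k with
  | zero => simpa using h0
  | succ k =>
    have := h k (by omega)
    rw [coeff_derivative, coeff_derivative] at this
    exact mul_right_cancel₀ (by positivity) this

/-! ### Algebraic properties of the scalar Fliess operator -/

theorem scalarFliess_add {m : ℕ} (c d : ScalarSeries m) (u : Signal m) :
    scalarFliess (c + d) u = scalarFliess c u + scalarFliess d u := by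
  ext n
  simp only [map_add, coeff_scalarFliess _ u le_rfl, ← Finset.sum_add_distrib, Pi.add_apply,
    add_mul]

theorem scalarFliess_neg {m : ℕ} (c : ScalarSeries m) (u : Signal m) :
    scalarFliess (-c) u = -scalarFliess c u := by
  ext n
  simp only [map_neg, coeff_scalarFliess _ u le_rfl, ← Finset.sum_neg_distrib, Pi.neg_apply,
    neg_mul]

theorem scalarFliess_zero {m : ℕ} (u : Signal m) : scalarFliess 0 u = 0 := by
  ext n
  simp [coeff_scalarFliess _ u le_rfl]

theorem scalarFliess_sum {ι : Type*} {m : ℕ} (s : Finset ι) (c : ι → ScalarSeries m)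
    (u : Signal m) : scalarFliess (∑ i ∈ s, c i) u = ∑ i ∈ s, scalarFliess (c i) u := by
  classical
  induction s using Finset.induction_on with
  | empty => simp [scalarFliess_zero]
  | insert i s hi ih => rw [Finset.sum_insert hi, Finset.sum_insert hi, scalarFliess_add, ih]

theorem scalarFliess_unit {m : ℕ} (u : Signal m) : scalarFliess (unit m) u = 1 := by
  refine derivative.ext ?_ ?_
  · rw [derivative_scalarFliess, derivative_one]
    exact Finset.sum_eq_zero fun i _ => by rw [shift_unit, scalarFliess_zero, mul_zero]
  · rw [constantCoeff_scalarFliess]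
    simp [unit]

/-- The Leibniz rule in time matches the Leibniz rule for left shifts. The induction is on the order
of agreement, for all `c`, `d` at once because differentiation replaces them by shifts. -/
theorem scalarFliess_shuffle {m : ℕ} (c d : ScalarSeries m) (u : Signal m) :
    scalarFliess (shuffle c d) u = scalarFliess c u * scalarFliess d u := by
  refine eq_of_forall_eqUpTo fun n => ?_
  induction n generalizing c d with
  | zero => exact fun k hk => absurd hk (by omega)
  | succ n ih =>
    refine EqUpTo.of_derivative ?_ ?_
    · rw [map_mul, constantCoeff_scalarFliess, constantCoeff_scalarFliess,
        constantCoeff_scalarFliess, shuffle_nil]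
    · have : d⁄dX ℝ (scalarFliess c u * scalarFliess d u) =
          ∑ i, extendedInput u i * (scalarFliess (shift i c) u * scalarFliess d u +
            scalarFliess c u * scalarFliess (shift i d) u) := by
        rw [Derivation.leibniz, derivative_scalarFliess, derivative_scalarFliess]
        simp only [smul_eq_mul, Finset.mul_sum, ← Finset.sum_add_distrib]
        exact Finset.sum_congr rfl fun i _ => by ring
      rw [derivative_scalarFliess, this]
      refine EqUpTo.sum fun i _ => (EqUpTo.refl _ _).mul ?_
      rw [shift_shuffle, scalarFliess_add]
      exact (ih _ _).add (ih _ _)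

/-- The Fliess operator is causal. -/
theorem scalarFliess_causal {m n : ℕ} {u v : Signal m} (h : ∀ i, EqUpTo n (u i) (v i))
    (c : ScalarSeries m) : EqUpTo (n + 1) (scalarFliess c u) (scalarFliess c v) := by
  induction n generalizing c with
  | zero =>
    refine EqUpTo.of_derivative (by simp only [constantCoeff_scalarFliess]) ?_
    exact fun k hk => absurd hk (by omega)
  | succ n ih =>
    refine EqUpTo.of_derivative (by simp only [constantCoeff_scalarFliess]) ?_
    rw [derivative_scalarFliess, derivative_scalarFliess]
    refine EqUpTo.sum fun i _ => EqUpTo.mul ?_ (ih (fun i => (h i).mono n.le_succ) _)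
    cases i using Fin.cases with
    | zero => exact EqUpTo.refl _ _
    | succ i => exact h i

/-! ### Substitutions -/

/-- The scalar version of `substitute`. -/
def scalarSubstitute {m n : ℕ} (φ : Fin (n + 1) → ScalarSeries m → ScalarSeries m)
    (c : ScalarSeries n) : ScalarSeries m := fun ξ =>
  ∑ᶠ η : Word n, c η * extendToWords φ η (unit m) ξ

theorem component_substitute {m n ℓ : ℕ} (φ : Fin (n + 1) → ScalarSeries m → ScalarSeries m)
    (c : Series n ℓ) (k : Fin ℓ) :
    component (substitute φ c) k = scalarSubstitute φ (component c k) := rfl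

/-- The family `φ` is given by `φ(x_i)(e) = ∑_j x_j (W_{ji} ⧢ e)`. -/
def IsShuffleFamily {m n : ℕ} (φ : Fin (n + 1) → ScalarSeries m → ScalarSeries m)
    (W : Fin (m + 1) → Fin (n + 1) → ScalarSeries m) : Prop :=
  ∀ i e, φ i e [] = 0 ∧ ∀ j ξ, φ i e (j :: ξ) = shuffle (W j i) e ξ

theorem shuffle_sum_right {m : ℕ} {ι : Type*} (s : Finset ι) (w : ScalarSeries m) (a : ι → ℝ)
    (g : ι → ScalarSeries m) (ξ : Word m) :
    shuffle w (fun ζ => ∑ η ∈ s, a η * g η ζ) ξ = ∑ η ∈ s, a η * shuffle w (g η) ξ := by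
  simp only [shuffle_eq_sum, Finset.mul_sum, Finset.sum_mul]
  rw [Finset.sum_comm]
  exact Finset.sum_congr rfl fun η _ => Finset.sum_congr rfl fun p _ => by ring

section

variable {m n : ℕ} {φ : Fin (n + 1) → ScalarSeries m → ScalarSeries m}
  {W : Fin (m + 1) → Fin (n + 1) → ScalarSeries m}

/-- Each `φ(x_i)` prefixes a letter, and shuffling does not lower the order. -/
theorem IsShuffleFamily.extendToWords_eq_zero (hφ : IsShuffleFamily φ W) (η : Word n) :
    ∀ ξ : Word m, ξ.length < η.length → extendToWords φ η (unit m) ξ = 0 := by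
  induction η with
  | nil => simp
  | cons i η ih =>
    intro ξ hξ
    rw [extendToWords]
    cases ξ with
    | nil => exact (hφ i _).1
    | cons j ξ =>
      rw [(hφ i _).2, shuffle_congr (d' := 0) (fun _ _ => rfl), shuffle_zero_right]
      · rfl
      · intro ζ hζ
        exact ih ζ (by simp at hξ; omega)

theorem IsShuffleFamily.scalarSubstitute_eq_sum (hφ : IsShuffleFamily φ W) (c : ScalarSeries n)
    {ξ : Word m} {N : ℕ} (h : ξ.length ≤ N) :
    scalarSubstitute φ c ξ = ∑ η ∈ wordsUpTo n N, c η * extendToWords φ η (unit m) ξ :=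
  finsum_eq_sum_wordsUpTo fun η hη => by
    rw [hφ.extendToWords_eq_zero η ξ (by omega), mul_zero]

theorem IsShuffleFamily.scalarSubstitute_nil (hφ : IsShuffleFamily φ W) (c : ScalarSeries n) :
    scalarSubstitute φ c [] = c [] := by
  have : wordsUpTo n 0 = {[]} := by
    ext η
    simp [mem_wordsUpTo]
  rw [hφ.scalarSubstitute_eq_sum c le_rfl]
  simp [this, extendToWords, unit]

theorem IsShuffleFamily.scalarSubstitute_cons (hφ : IsShuffleFamily φ W) (c : ScalarSeries n)
    (j : Fin (m + 1)) (ξ : Word m) :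
    scalarSubstitute φ c (j :: ξ) =
      ∑ i, shuffle (W j i) (scalarSubstitute φ (shift i c)) ξ := by
  rw [scalarSubstitute, finsum_word_cons (n := ξ.length + 1)]
  · have : unit m (j :: ξ) = 0 := by simp [unit]
    rw [extendToWords, this, mul_zero, zero_add]
    refine Finset.sum_congr rfl fun i _ => ?_
    -- At `ξ` the shuffle sees only words of length at most `|ξ|`, so the substituted series can be
    -- truncated to one fixed finite sum and linearity applies.
    rw [shuffle_congr (fun _ _ => rfl) fun ζ hζ => hφ.scalarSubstitute_eq_sum (shift i c) hζ,
      shuffle_sum_right, finsum_eq_sum_wordsUpTo (n := ξ.length)]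
    · exact Finset.sum_congr rfl fun η _ => by rw [extendToWords, (hφ i _).2, shift]
    · intro η hη
      rw [hφ.extendToWords_eq_zero _ _ (by simpa using hη), mul_zero]
  · intro η hη
    rw [hφ.extendToWords_eq_zero _ _ (by simpa using hη), mul_zero]

theorem IsShuffleFamily.shift_scalarSubstitute (hφ : IsShuffleFamily φ W) (c : ScalarSeries n)
    (j : Fin (m + 1)) :
    shift j (scalarSubstitute φ c) = ∑ i, shuffle (W j i) (scalarSubstitute φ (shift i c)) :=
  funext fun ξ => by
    rw [Finset.sum_apply]
    exact hφ.scalarSubstitute_cons c j ξ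

/-- A substitution generates the composition of operators. -/
theorem IsShuffleFamily.scalarFliess_scalarSubstitute (hφ : IsShuffleFamily φ W) {u : Signal m}
    {v : Signal n}
    (huv : ∀ i, ∑ j, extendedInput u j * scalarFliess (W j i) u = extendedInput v i)
    (c : ScalarSeries n) : scalarFliess (scalarSubstitute φ c) u = scalarFliess c v := by
  refine eq_of_forall_eqUpTo fun N => ?_
  induction N generalizing c with
  | zero => exact fun k hk => absurd hk (by omega)
  | succ N ih =>
    refine EqUpTo.of_derivative ?_ ?_
    · rw [constantCoeff_scalarFliess, constantCoeff_scalarFliess, hφ.scalarSubstitute_nil]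
    -- Exchanging the sums over `i` and `j` lets `huv` collect the factors `W j i` into the input
    -- `v`.
    · have : d⁄dX ℝ (scalarFliess (scalarSubstitute φ c) u) =
          ∑ i, extendedInput v i * scalarFliess (scalarSubstitute φ (shift i c)) u := by
        rw [derivative_scalarFliess]
        simp only [hφ.shift_scalarSubstitute, scalarFliess_sum, scalarFliess_shuffle, ← huv,
          Finset.mul_sum, Finset.sum_mul]
        rw [Finset.sum_comm]
        exact Finset.sum_congr rfl fun i _ => Finset.sum_congr rfl fun j _ => by ring
      rw [this, derivative_scalarFliess]
      exact EqUpTo.sum fun i _ => (EqUpTo.refl _ _).mul (ih _)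

end

/-! ### The composition products -/

theorem isShuffleFamily_psi {m n : ℕ} (d : Series m n) :
    IsShuffleFamily (psi d)
      (fun j i => if j = 0 then Fin.cases (unit m) (component d) i else 0) := by
  intro i e
  refine ⟨rfl, fun j ξ => ?_⟩
  by_cases hj : j = 0 <;> simp [psi, letterMul, hj, shuffle_zero_left]

theorem isShuffleFamily_phi {m : ℕ} (d : Series m m) :
    IsShuffleFamily (phi d) (fun j i => (if j = i then unit m else 0) +
      if j = 0 then Fin.cases 0 (component d) i else 0) := by
  intro i e
  refine ⟨by simp [phi, letterMul], fun j ξ => ?_⟩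
  rw [shuffle_add_left]
  simp only [phi, Pi.add_apply, letterMul]
  congr 1 <;> split_ifs <;> simp [shuffle_zero_left, unit_shuffle]

theorem fliess_comp {m n ℓ : ℕ} (c : Series n ℓ) (d : Series m n) (u : Signal m) :
    fliess (comp c d) u = fliess c (fliess d u) := by
  funext k
  rw [fliess_apply, fliess_apply, comp, component_substitute]
  refine (isShuffleFamily_psi d).scalarFliess_scalarSubstitute (fun i => ?_) _
  rw [Finset.sum_eq_single 0 (fun j _ hj => by simp [hj, scalarFliess_zero]) (by simp)]
  cases i using Fin.cases with
  | zero => simp [extendedInput, scalarFliess_unit]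
  | succ i => simp [extendedInput, fliess_apply]

theorem fliess_modComp {m ℓ : ℕ} (c : Series m ℓ) (d : Series m m) (u : Signal m) :
    fliess (modComp c d) u = fliess c (u + fliess d u) := by
  funext k
  rw [fliess_apply, fliess_apply, modComp, component_substitute]
  refine (isShuffleFamily_phi d).scalarFliess_scalarSubstitute (fun i => ?_) _
  simp only [scalarFliess_add, mul_add, Finset.sum_add_distrib]
  rw [Finset.sum_eq_single i (fun j _ hj => by simp [hj, scalarFliess_zero]) (by simp),
    Finset.sum_eq_single 0 (fun j _ hj => by simp [hj, scalarFliess_zero]) (by simp)]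
  cases i using Fin.cases with
  | zero => simp [extendedInput, scalarFliess_unit, scalarFliess_zero]
  | succ i => simp [extendedInput, scalarFliess_unit, fliess_apply]

theorem compDelta_eq_modComp {m ℓ : ℕ} (c : Series m ℓ) (a : DeltaSeries m) :
    compDelta c a = modComp c a.series := by
  have : psiDelta a = phi a.series := by
    funext i e
    cases i using Fin.cases with
    | zero =>
      simp only [psiDelta, phi, Fin.cases_zero, shuffle_zero_left]
      funext ξ
      cases ξ <;> simp [letterMul]
    | succ i => rfl
  rw [compDelta, modComp, this]

/-- The coefficients of the modified composition product at words of length at most `N` depend on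
the right factor only through its coefficients at shorter words. -/
theorem modComp_congr {m ℓ : ℕ} (c : Series m ℓ) {d d' : Series m m} {N : ℕ}
    (h : ∀ η : Word m, η.length < N → d η = d' η) (ξ : Word m) (hξ : ξ.length ≤ N) :
    modComp c d ξ = modComp c d' ξ := by
  -- The left factor must vary, since the recursion replaces it by its shifts.
  suffices H : ∀ (L : ℕ) (a : ScalarSeries m) (ξ : Word m), ξ.length ≤ L → L ≤ N →
      scalarSubstitute (phi d) a ξ = scalarSubstitute (phi d') a ξ from
    funext fun k => H N (component c k) ξ hξ le_rfl
  intro L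
  induction L with
  | zero =>
    intro a ξ h0 _
    rw [List.length_eq_zero_iff.mp (Nat.le_zero.mp h0),
      (isShuffleFamily_phi d).scalarSubstitute_nil, (isShuffleFamily_phi d').scalarSubstitute_nil]
  | succ L ih =>
    intro a ξ hL hN
    cases ξ with
    | nil =>
      rw [(isShuffleFamily_phi d).scalarSubstitute_nil,
        (isShuffleFamily_phi d').scalarSubstitute_nil]
    | cons j ξ =>
      rw [List.length_cons] at hL
      rw [(isShuffleFamily_phi d).scalarSubstitute_cons,
        (isShuffleFamily_phi d').scalarSubstitute_cons]
      -- The prefixed letter uses up one unit of length, so `d` is evaluated only at words strictly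
      -- shorter than `N`.
      refine Finset.sum_congr rfl fun i _ => shuffle_congr (fun η hη => ?_)
        fun η hη => ih _ η (by omega) (by omega)
      cases i using Fin.cases with
      | zero => rfl
      | succ i =>
        by_cases hj : j = 0 <;> simp [hj, component, h η (by omega)]

/-! ### A series is determined by its Fliess operator -/

section

open Filter Topology

variable {m : ℕ} (u : Signal m) (i : Fin m)

/-- The input `u` with `X ^ p` added to its `i`-th component. -/
def perturb (p : ℕ) : Signal m := u + Pi.single i (X ^ p)

theorem extendedInput_perturb (p : ℕ) (j : Fin (m + 1)) :
    extendedInput (perturb u i p) j = extendedInput u j + if j = i.succ then X ^ p else 0 := by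
  cases j using Fin.cases with
  | zero => simp [extendedInput, (Fin.succ_ne_zero i).symm]
  | succ j =>
    by_cases h : j = i
    · subst h
      simp [extendedInput, perturb]
    · simp [extendedInput, perturb, h]

theorem perturb_eqUpTo (p : ℕ) (j : Fin m) : EqUpTo p (perturb u i p j) (u j) := by
  intro k hk
  by_cases h : j = i
  · subst h
    simp [perturb, coeff_X_pow, hk.ne]
  · simp [perturb, h]

/-- The difference quotient `(F_c[u + X ^ p e_i] - F_c[u]) / X ^ p`. -/
def perturbQuotient (c : ScalarSeries m) (p : ℕ) : PowerSeries ℝ :=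
  PowerSeries.mk fun q => coeff (p + q) (scalarFliess c (perturb u i p) - scalarFliess c u)

theorem X_pow_mul_perturbQuotient (c : ScalarSeries m) (p : ℕ) :
    X ^ p * perturbQuotient u i c p = scalarFliess c (perturb u i p) - scalarFliess c u := by
  ext n
  rw [coeff_X_pow_mul']
  split_ifs with h
  · rw [perturbQuotient, coeff_mk, Nat.add_sub_cancel' h]
  · rw [map_sub, scalarFliess_causal (perturb_eqUpTo u i p) c n (by omega), sub_self]

theorem coeff_zero_perturbQuotient (c : ScalarSeries m) (p : ℕ) :
    coeff 0 (perturbQuotient u i c p) = 0 := by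
  rw [perturbQuotient, coeff_mk, add_zero, map_sub,
    scalarFliess_causal (perturb_eqUpTo u i p) c p p.lt_succ_self, sub_self]

/-- This is the coefficient of degree `p + q` in the derivative of `X ^ p` times the quotient. The
growing factor `p + q + 1` comes from differentiation; the last term is the contribution of the
added input `X ^ p`. -/
theorem coeff_succ_perturbQuotient (c : ScalarSeries m) (p q : ℕ) :
    ((p : ℝ) + q + 1) * coeff (q + 1) (perturbQuotient u i c p) =
      ∑ j, coeff q (extendedInput u j * perturbQuotient u i (shift j c) p) +
        coeff q (scalarFliess (shift i.succ c) (perturb u i p)) := by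
  have h1 : ((p : ℝ) + q + 1) * coeff (q + 1) (perturbQuotient u i c p) =
      coeff (p + q) (d⁄dX ℝ (scalarFliess c (perturb u i p) - scalarFliess c u)) := by
    rw [coeff_derivative, perturbQuotient, coeff_mk, mul_comm, ← add_assoc]
    push_cast
    rfl
  have h2 : d⁄dX ℝ (scalarFliess c (perturb u i p) - scalarFliess c u) =
      X ^ p * (∑ j, extendedInput u j * perturbQuotient u i (shift j c) p +
        scalarFliess (shift i.succ c) (perturb u i p)) := by
    rw [map_sub, derivative_scalarFliess, derivative_scalarFliess, mul_add, Finset.mul_sum]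
    simp only [mul_left_comm (X ^ p), X_pow_mul_perturbQuotient, extendedInput_perturb, add_mul,
      Finset.sum_add_distrib, mul_sub, Finset.sum_sub_distrib, ite_mul, zero_mul,
      Finset.sum_ite_eq', Finset.mem_univ, if_true]
    ring
  rw [h1, h2, add_comm p q, coeff_X_pow_mul, map_add, map_sum]

theorem tendsto_coeff_succ_perturbQuotient {q : ℕ}
    (h : ∀ k ≤ q, ∀ c : ScalarSeries m,
      Tendsto (fun p => coeff k (perturbQuotient u i c p)) atTop (𝓝 0)) (c : ScalarSeries m) :
    Tendsto (fun p : ℕ => ((p : ℝ) + q + 1) * coeff (q + 1) (perturbQuotient u i c p)) atTop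
      (𝓝 (coeff q (scalarFliess (shift i.succ c) u))) := by
  simp only [coeff_succ_perturbQuotient]
  rw [← zero_add (coeff q (scalarFliess (shift i.succ c) u))]
  refine Tendsto.add ?_ ?_
  · rw [← Finset.sum_const_zero (s := (Finset.univ : Finset (Fin (m + 1))))]
    refine tendsto_finsetSum _ fun j _ => ?_
    simp only [coeff_mul]
    rw [← Finset.sum_const_zero (s := Finset.HasAntidiagonal.antidiagonal q)]
    refine tendsto_finsetSum _ fun k hk => ?_
    rw [Finset.HasAntidiagonal.mem_antidiagonal] at hk
    simpa using (h k.2 (by omega) (shift j c)).const_mul (coeff k.1 (extendedInput u j))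
  -- By causality this coefficient no longer depends on `p` once `p ≥ q`.
  · refine tendsto_const_nhds.congr' ?_
    filter_upwards [eventually_ge_atTop q] with p hp
    exact (scalarFliess_causal (perturb_eqUpTo u i p) _ q (by omega)).symm

/-- Multiplied by `p + q + 1` the next coefficient still converges, so the coefficient itself tends
to `0`. -/
theorem tendsto_coeff_perturbQuotient (q : ℕ) : ∀ c : ScalarSeries m,
    Tendsto (fun p => coeff q (perturbQuotient u i c p)) atTop (𝓝 0) := by
  induction q using Nat.strong_induction_on with
  | _ q ih =>
    intro c
    cases q with
    | zero => simp only [coeff_zero_perturbQuotient, tendsto_const_nhds]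
    | succ q =>
      have h1 := tendsto_coeff_succ_perturbQuotient u i
        (fun k hk => ih k (Nat.lt_succ_of_le hk)) c
      have h2 : Tendsto (fun p : ℕ => ((p : ℝ) + q + 1)⁻¹) atTop (𝓝 0) :=
        tendsto_inv_atTop_zero.comp (tendsto_atTop_add_const_right _ _
          (tendsto_atTop_add_const_right _ _ tendsto_natCast_atTop_atTop))
      have h3 := h2.mul h1
      rw [zero_mul] at h3
      refine h3.congr fun p => ?_
      have : (p : ℝ) + q + 1 ≠ 0 := by positivity
      rw [← mul_assoc, inv_mul_cancel₀ this, one_mul]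

end

/-- All perturbation quotients vanish, hence so does their rescaled limit, which settles the letters
`x_i` with `i ≥ 1`. In the derivative formula only the `x₀` term then remains, and `u₀ = 1`. -/
theorem scalarFliess_shift_eq_zero {m : ℕ} {c : ScalarSeries m} (h : ∀ u, scalarFliess c u = 0)
    (i : Fin (m + 1)) (u : Signal m) : scalarFliess (shift i c) u = 0 := by
  have hsucc : ∀ i : Fin m, scalarFliess (shift i.succ c) u = 0 := by
    intro i
    ext q
    refine tendsto_nhds_unique (tendsto_coeff_succ_perturbQuotient u i
      (fun k _ => tendsto_coeff_perturbQuotient u i k) c) ?_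
    have : ∀ p, perturbQuotient u i c p = 0 := fun p => by
      ext q
      simp [perturbQuotient, h]
    simp [this]
  cases i using Fin.cases with
  | succ i => exact hsucc i
  | zero =>
    have := derivative_scalarFliess c u
    rw [h, map_zero, Fin.sum_univ_succ] at this
    simpa [hsucc, extendedInput] using this.symm

theorem eq_zero_of_scalarFliess_eq_zero {m : ℕ} {c : ScalarSeries m}
    (h : ∀ u, scalarFliess c u = 0) : c = 0 := by
  funext η
  induction η generalizing c with
  | nil => rw [← constantCoeff_scalarFliess c 0, h, map_zero]; rfl
  | cons i η ih => exact ih (scalarFliess_shift_eq_zero h i)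

theorem fliess_injective {m ℓ : ℕ} :
    Function.Injective (fliess : Series m ℓ → Signal m → Signal ℓ) := by
  intro c d h
  have hk : ∀ k, component c k + -component d k = 0 := fun k =>
    eq_zero_of_scalarFliess_eq_zero fun u => by
      rw [scalarFliess_add, scalarFliess_neg, ← fliess_apply, ← fliess_apply, h, add_neg_cancel]
  funext η k
  have := congrFun (hk k) η
  exact add_neg_eq_zero.mp this

/-! ### The output feedback group -/

theorem fliess_add {m ℓ : ℕ} (c d : Series m ℓ) (u : Signal m) :
    fliess (c + d) u = fliess c u + fliess d u :=
  funext fun k => scalarFliess_add (component c k) (component d k) u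

theorem fliess_neg {m ℓ : ℕ} (c : Series m ℓ) (u : Signal m) : fliess (-c) u = -fliess c u :=
  funext fun k => scalarFliess_neg (component c k) u

theorem fliess_zero {m ℓ : ℕ} (u : Signal m) : fliess (0 : Series m ℓ) u = 0 :=
  funext fun _ => scalarFliess_zero u

/-- The operator `u ↦ u + F_c[u]` generated by `δ + c`. -/
def deltaFliess {m : ℕ} (a : DeltaSeries m) (u : Signal m) : Signal m := u + fliess a.series u

theorem deltaFliess_injective {m : ℕ} :
    Function.Injective (deltaFliess : DeltaSeries m → Signal m → Signal m) := fun _ _ h =>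
  DeltaSeries.ext (fliess_injective (funext fun u => add_left_cancel (congrFun h u)))

theorem deltaFliess_mul {m : ℕ} (a b : DeltaSeries m) (u : Signal m) :
    deltaFliess (a * b) u = deltaFliess a (deltaFliess b u) := by
  change u + fliess (b.series + modComp a.series b.series) u = _
  rw [fliess_add, fliess_modComp, ← add_assoc]
  rfl

theorem deltaFliess_one {m : ℕ} (u : Signal m) : deltaFliess 1 u = u := by
  change u + fliess 0 u = u
  rw [fliess_zero, add_zero]

theorem DeltaSeries.mul_assoc' {m : ℕ} (a b e : DeltaSeries m) : a * b * e = a * (b * e) :=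
  deltaFliess_injective (funext fun u => by simp only [deltaFliess_mul])

theorem DeltaSeries.one_mul' {m : ℕ} (a : DeltaSeries m) : 1 * a = a :=
  deltaFliess_injective (funext fun u => by rw [deltaFliess_mul, deltaFliess_one])

theorem DeltaSeries.mul_one' {m : ℕ} (a : DeltaSeries m) : a * 1 = a :=
  deltaFliess_injective (funext fun u => by rw [deltaFliess_mul, deltaFliess_one])

/-- The iterates of `b ↦ -(a õ b)`, which converge to the inverse of `a`. -/
def inverseIterate {m : ℕ} (a : Series m m) : ℕ → Series m m
  | 0 => 0
  | n + 1 => -modComp a (inverseIterate a n)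

/-- By `modComp_congr`, each iteration settles the coefficients at words of one further length. -/
theorem inverseIterate_stable {m : ℕ} (a : Series m m) (n : ℕ) : ∀ η : Word m, η.length < n →
    inverseIterate a (n + 1) η = inverseIterate a n η := by
  induction n with
  | zero => simp
  | succ n ih =>
    intro η hη
    rw [inverseIterate, Pi.neg_apply, modComp_congr a ih η (by omega), ← Pi.neg_apply]
    rfl

theorem inverseIterate_eq {m : ℕ} (a : Series m m) {n : ℕ} {η : Word m} (h : η.length < n) :
    inverseIterate a n η = inverseIterate a (η.length + 1) η := by
  induction n, (show η.length + 1 ≤ n from h) using Nat.le_induction with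
  | base => rfl
  | succ n hn ih => rw [inverseIterate_stable a n η hn, ih hn]

theorem DeltaSeries.exists_mul_eq_one {m : ℕ} (a : DeltaSeries m) : ∃ b, a * b = 1 := by
  -- The index `|η| + 1` is the first one from which stability at `η` is guaranteed.
  let b : Series m m := fun η => inverseIterate a.series (η.length + 1) η
  refine ⟨⟨b⟩, DeltaSeries.ext ?_⟩
  change b + modComp a.series b = 0
  funext η
  have h : ∀ ξ : Word m, ξ.length < η.length → b ξ = inverseIterate a.series η.length ξ :=
    fun ξ hξ => (inverseIterate_eq a.series hξ).symm
  rw [Pi.add_apply, modComp_congr a.series h η le_rfl]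
  -- By definition `b η` unfolds to minus the modified composition of `a.series` with iterate number
  -- `|η|`, evaluated at `η`.
  exact neg_add_cancel _

/-- In a monoid where every element has a right inverse, the right inverse of `b` is `a` itself. -/
theorem DeltaSeries.exists_inverse {m : ℕ} (a : DeltaSeries m) : ∃ b, a * b = 1 ∧ b * a = 1 := by
  obtain ⟨b, hb⟩ := a.exists_mul_eq_one
  obtain ⟨e, he⟩ := b.exists_mul_eq_one
  have : a = e := by rw [← a.mul_one', ← he, ← mul_assoc', hb, one_mul']
  exact ⟨b, hb, by rw [this, he]⟩

theorem DeltaSeries.inv_spec {m : ℕ} (a : DeltaSeries m) : a * a⁻¹ = 1 ∧ a⁻¹ * a = 1 :=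
  Classical.epsilon_spec a.exists_inverse

theorem deltaFliess_eq_iff {m : ℕ} (a : DeltaSeries m) (u v : Signal m) :
    deltaFliess a v = u ↔ v = deltaFliess a⁻¹ u := by
  constructor
  · rintro rfl
    rw [← deltaFliess_mul, a.inv_spec.2, deltaFliess_one]
  · rintro rfl
    rw [← deltaFliess_mul, a.inv_spec.1, deltaFliess_one]

/-! ### The feedback product -/

section

variable {mc md : ℕ} (c : Series mc md) (d : Series md mc)

theorem isFeedbackSeries_modComp_groupInv :
    IsFeedbackSeries c d (modComp c (groupInv (-comp d c))) := by
  intro u y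
  -- With `y` eliminated, the loop says that `δ - d ∘ c` maps `v` to `u`.
  have hloop : ∀ v : Signal mc, v = u + fliess d (fliess c v) ↔
      v = deltaFliess (⟨-comp d c⟩ : DeltaSeries mc)⁻¹ u := by
    intro v
    rw [← deltaFliess_eq_iff, deltaFliess, fliess_neg, fliess_comp, ← sub_eq_add_neg,
      sub_eq_iff_eq_add]
  rw [fliess_modComp]
  change _ ↔ y = fliess c (deltaFliess (⟨-comp d c⟩ : DeltaSeries mc)⁻¹ u)
  constructor
  · rintro ⟨v, hv, rfl⟩
    rw [← (hloop v).mp hv]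
  · rintro rfl
    exact ⟨_, (hloop _).mpr rfl, rfl⟩

variable {c d}

/-- The output `F_e[u]` solves the loop, so it is the unique output `F_{e'}[u]`. -/
theorem IsFeedbackSeries.eq {e e' : Series mc md} (h : IsFeedbackSeries c d e)
    (h' : IsFeedbackSeries c d e') : e = e' :=
  fliess_injective (funext fun u => (h' u _).mp ((h u _).mpr rfl))

theorem isFeedbackSeries_iff {e : Series mc md} :
    IsFeedbackSeries c d e ↔ e = feedback c d := by
  have h : IsFeedbackSeries c d (feedback c d) :=
    Classical.epsilon_spec ⟨_, isFeedbackSeries_modComp_groupInv c d⟩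
  exact ⟨fun he => he.eq h, fun he => he ▸ h⟩

theorem feedback_eq : feedback c d = modComp c (groupInv (-comp d c)) :=
  (isFeedbackSeries_iff.mp (isFeedbackSeries_modComp_groupInv c d)).symm

theorem eq_modComp_comp_iff {e : Series mc md} :
    e = modComp c (comp d e) ↔ e = feedback c d := by
  have h : IsFeedbackSeries c d (feedback c d) := isFeedbackSeries_iff.mpr rfl
  constructor
  · intro he
    -- With `y = F_e[u]` and `v = u + F_d[y]`, the fixed-point equation becomes `y = F_c[v]`;
    -- uniqueness of the loop output concludes.
    refine fliess_injective (funext fun u => (h u _).mp ⟨_, rfl, ?_⟩)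
    conv_lhs => rw [he]
    rw [fliess_modComp, fliess_comp]
  · rintro rfl
    refine fliess_injective (funext fun u => ?_)
    obtain ⟨v, hv, hy⟩ := (h u _).mpr rfl
    rw [fliess_modComp, fliess_comp, ← hv, hy]

end

end FliessSeries

end

theorem mainTheorem3 (mc md : ℕ) (c : Series mc md) (d : Series md mc) :
    -- `(DeltaSeries mc, ∘, δ)` is a group and `⁻¹` is its inverse
    ((∀ a b e : DeltaSeries mc, a * b * e = a * (b * e)) ∧
      (∀ a : DeltaSeries mc, 1 * a = a ∧ a * 1 = a) ∧
      (∀ a : DeltaSeries mc, a * a⁻¹ = 1 ∧ a⁻¹ * a = 1)) ∧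
    -- `c @ d` is the unique generating series of the feedback connection
    (∀ e : Series mc md, IsFeedbackSeries c d e ↔ e = feedback c d) ∧
    -- equivalently, the unique fixed point of the loop map on series
    (∀ e : Series mc md, e = modComp c (comp d e) ↔ e = feedback c d) ∧
    -- the feedback product formulas
    feedback c d = modComp c (groupInv (-comp d c)) ∧
    feedback c d = compDelta c (⟨-comp d c⟩ : DeltaSeries mc)⁻¹ :=
  ⟨⟨DeltaSeries.mul_assoc', fun a => ⟨a.one_mul', a.mul_one'⟩, DeltaSeries.inv_spec⟩,
    fun _ => isFeedbackSeries_iff, fun _ => eq_modComp_comp_iff, feedback_eq,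
    by rw [compDelta_eq_modComp]; exact feedback_eq⟩
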